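/- Let $\alpha\in(0,1)$, let $\zeta(1/\alpha)=\sum_{k\ge 1}k^{-1/\alpha}$, and let $P=\{p_k:k\ge1\}$ be the probability distribution on $\{1,2,\dots\}$ given by $$p_k=\frac{k^{-1/\alpha}}{\zeta(1/\alpha)},\qquad k\ge 1.$$ For $\varepsilon>0$ let $\nu(\varepsilon)=|\{k\ge1:p_k\ge\varepsilon\}|$ and, for $\varepsilon\in(0,1]$, $$\kappa_-(\varepsilon)=\sup_{0<u\le\varepsilon}\frac{\nu(u)}{\nu(u/2)}.$$ For $s>0$ and $x\ge0$ let $\gamma(s,x)=\int_0^x u^{s-1}e^{-u}\,\mathrm{d}u$. Let $n$ be an integer with $n\ge\max\{2,\,2^{1/\alpha}\zeta(1/\alpha)\}$ such that $$\kappa_-\left(\frac2n\right)\le\frac{2^\alpha+1}{2^{\alpha+1}}\qquad\text{and}\qquad\int_0^2u^{-\alpha}\left(1-\frac un\right)^n\mathrm{d}u\ge\frac{\gamma(1-\alpha,2)}{2}.$$ Let $X_1,\dots,X_n$ be independent random variables on a probability space, each with distribution $P$, and let $$M_{n,0}=\sum_{k\ge1}p_k\,\mathbf 1\{X_i\ne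 k\text{ for all }1\le i\le n\}$$ be the missing mass. Then, for all $t>0$, $$\mathbb P\left(m^-_{n,0}(t,\alpha)\le M_{n,0}\le m^+_{n,0}(t,\alpha)\right)\ge 1-2e^{-t},$$ where $$m^-_{n,0}(t,\alpha)=\frac{(2^\alpha-1)\,\gamma(1-\alpha,2)}{32}\,\frac{\zeta(1/\alpha)^{-\alpha}}{n^{1-\alpha}}-\sqrt{\frac{2t}{ne}},$$ $$m^+_{n,0}(t,\alpha)=\left(e^{-1}+4\,\gamma\left(1-\alpha,\tfrac12\right)\right)\frac{\zeta(1/\alpha)^{-\alpha}}{n^{1-\alpha}}+\sqrt{\frac tn}.$$ -/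

import Mathlib

open MeasureTheory ProbabilityTheory
open scoped ENNReal

noncomputable section

/-- The alphabet `{1, 2, …}` carries its discrete σ-algebra. -/
instance instMeasurableSpacePNat : MeasurableSpace ℕ+ := ⊤

instance instDiscreteMeasurableSpacePNat : DiscreteMeasurableSpace ℕ+ :=
  ⟨fun _ => trivial⟩

/-- The lower incomplete Gamma function `γ(t, x) = ∫₀ˣ u ^ (t - 1) e ^ (-u) du`. -/
def lowerGamma (t x : ℝ) : ℝ :=
  ∫ u in (0 : ℝ)..x, u ^ (t - 1) * Real.exp (-u)

/-- The counting function `ν(ε) = |{a : p a ≥ ε}|` of a family of masses `p`, possibly infinite. -/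
def countingFn {A : Type*} (p : A → ℝ) (ε : ℝ) : ℕ∞ :=
  Set.encard {a | ε ≤ p a}

/-- `κ₋(ε) = sup_{0 < u ≤ ε} ν(u) / ν(u / 2)`, as a supremum in `[0, ∞]`. -/
def kappaMinus {A : Type*} (p : A → ℝ) (ε : ℝ) : ℝ≥0∞ :=
  ⨆ u ∈ Set.Ioc (0 : ℝ) ε,
    (countingFn p u : ℝ≥0∞) / (countingFn p (u / 2) : ℝ≥0∞)

/-- `ξₙ(a)`, the number of indices `i` with `x i = a` in a sample `x` of size `n`. -/
def sampleCount {A : Type*} {n : ℕ} (x : Fin n → A) (a : A) : ℕ :=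
  Set.ncard {i | x i = a}

open Classical in
/-- The occupancy probability `M_{n,r} = ∑ₐ p a 1{ξₙ(a) = r}` of a sample `x` of size `n`;
the missing mass is the case `r = 0`. -/
def occupancyProb {A : Type*} (p : A → ℝ) {n : ℕ} (x : Fin n → A) (r : ℕ) : ℝ :=
  ∑' a, p a * (if sampleCount x a = r then 1 else 0)

/-- The zeta series `ζ(s) = ∑_{k ≥ 1} k ^ (-s)`, for real `s > 1`. -/
def zetaSeries (s : ℝ) : ℝ :=
  ∑' k : ℕ+, (k : ℝ) ^ (-s)

/-- The Zipf masses `p_k = k ^ (-1/α) / ζ(1/α)`, `k ≥ 1`. -/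
def zipfProb (α : ℝ) (k : ℕ+) : ℝ :=
  (k : ℝ) ^ (-(1 / α)) / zetaSeries (1 / α)

/-- The lower bound `m⁻_{n,0}(t, α)`. -/
def missingMassLower (n : ℕ) (t α : ℝ) : ℝ :=
  (2 ^ α - 1) * lowerGamma (1 - α) 2 / 32 * (zetaSeries (1 / α) ^ (-α) / (n : ℝ) ^ (1 - α))
    - √(2 * t / (n * Real.exp 1))

/-- The upper bound `m⁺_{n,0}(t, α)`. -/
def missingMassUpper (n : ℕ) (t α : ℝ) : ℝ :=
  (Real.exp (-1) + 4 * lowerGamma (1 - α) (1 / 2))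
      * (zetaSeries (1 / α) ^ (-α) / (n : ℝ) ^ (1 - α))
    + √(t / n)

theorem summable_zetaSeries {s : ℝ} (hs : 1 < s) :
    Summable fun k : ℕ+ => (k : ℝ) ^ (-s) := by
  have h : Summable fun k : ℕ => (k : ℝ) ^ (-s) := Real.summable_nat_rpow.2 (by linarith)
  exact h.comp_injective PNat.coe_injective

theorem zetaSeries_pos {s : ℝ} (hs : 1 < s) : 0 < zetaSeries s :=
  (summable_zetaSeries hs).tsum_pos (fun k => by positivity) 1 (by simp)

/-- The series agrees with the Riemann zeta function. -/
theorem ofReal_zetaSeries {s : ℝ} (hs : 1 < s) : (zetaSeries s : ℂ) = riemannZeta s := by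
  have h := tsum_pnat_eq_tsum_succ (f := fun k : ℕ => 1 / (k : ℂ) ^ (s : ℂ))
  rw [zeta_eq_tsum_one_div_nat_add_one_cpow (by simpa using hs), zetaSeries, Complex.ofReal_tsum]
  push_cast at h
  rw [← h]
  refine tsum_congr fun k => ?_
  rw [Real.rpow_neg (by positivity), Complex.ofReal_inv, Complex.ofReal_cpow (by positivity)]
  simp

/-- The Zipf masses form a probability distribution on `{1, 2, …}`. -/
theorem hasSum_zipfProb {α : ℝ} (h0 : 0 < α) (h1 : α < 1) : HasSum (zipfProb α) 1 := by
  have hs : 1 < 1 / α := by rw [lt_div_iff₀ h0]; linarith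
  have h := (summable_zetaSeries hs).hasSum.div_const (zetaSeries (1 / α))
  change HasSum _ (zetaSeries (1 / α) / zetaSeries (1 / α)) at h
  rw [div_self (zetaSeries_pos hs).ne'] at h
  exact h

end

/-!
Write `M` for the missing mass and `E = ∑ p_k (1 - p_k) ^ n` for its mean. The theorem follows from
two one-sided deviation inequalities, each of probability at most `exp (-t)`, valid for any
distribution, and from upper and lower bounds for `E` under Zipf's law.

*Deviations.* `M = ∑ p_k B_k`, where `B_k` indicates that the letter `k` does not occur. The `B_k`
are dependent, but negatively so: the moment generating function of `M`, at either sign of its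
argument, is at most what it would be for independent `B_k` (`integral_prod_one_sub_unseen_le`).
This is proved by induction on the sample size: conditioning on one more letter turns the claim
into Bernoulli's inequality for products. What remains concerns a single Bernoulli variable of
parameter `q = (1 - p) ^ n`. For the lower tail, `exp (-x) ≤ 1 - x + x ^ 2 / 2` and
`p * q ≤ 1 / (n e)` suffice. For the upper tail the second moment is too large for small `p`, and
the Kearns–Saul inequality takes its place (`bernoulli_mgf_le`). It amounts to the concavity of
`u ↦ log (cosh √u)`, and its constant is compared with `-log q ≥ n p` by the concavity of
`q ↦ log (1 - q) - 2 q log q`. Finite sums give the series by dominated convergence.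

*Mean.* Let `K = (n / ζ(1/α)) ^ α`, so that `p_k ≥ 1 / n` exactly for `k ≤ K`, and
`ζ(1/α) ^ (-α) / n ^ (1 - α) = K / n`. The letters `k ≤ K` contribute at most `1 / (n e)` each to
`E`, and the others at most their total mass and at least a quarter of it. Comparison with an
integral shows that this mass is of order `α / (1 - α) * K / n`, up to the factor
`(1 + 1 / K) ^ (1 / α - 1)` in the lower bound. If `K` were small compared with `1 / α`, that factor
would be large; the bound on `κ₋` excludes this: as it is smaller than `1`, there is, for the first
`m` with `p_m ≤ 2 / n`, some further letter of mass at least `p_m / 2`, that is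
`m + 1 ≤ 2 ^ α * m` (`one_add_inv_zipfCutoff_rpow_le`).
-/

/-! ### Elementary inequalities -/

/-- Bernoulli's inequality for a product whose increments all have the same sign. -/
theorem one_add_sum_le_prod_one_add_of_same_sign {A : Type*} (S : Finset A) (x : A → ℝ)
    (hx : (∀ a, 0 ≤ x a) ∨ ∀ a, -1 ≤ x a ∧ x a ≤ 0) :
    1 + ∑ a ∈ S, x a ≤ ∏ a ∈ S, (1 + x a) := by
  classical
  rcases hx with hx | hx
  · induction S using Finset.induction_on with
    | empty => simp
    | insert a S ha ih =>
      rw [Finset.sum_insert ha, Finset.prod_insert ha]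
      have := mul_le_mul_of_nonneg_left ih (by linarith [hx a] : 0 ≤ 1 + x a)
      nlinarith [hx a, Finset.sum_nonneg fun b (_ : b ∈ S) => hx b]
  · induction S using Finset.induction_on with
    | empty => simp
    | insert a S ha ih =>
      rw [Finset.sum_insert ha, Finset.prod_insert ha]
      have h1 : ∏ b ∈ S, (1 + x b) ≤ 1 :=
        Finset.prod_le_one (fun b _ => by linarith [hx b]) fun b _ => by linarith [hx b]
      nlinarith [hx a]

theorem antitoneOn_sinh_div_mul_cosh :
    AntitoneOn (fun x => Real.sinh x / (x * Real.cosh x)) (Set.Ioi 0) := by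
  have hd : ∀ x ∈ Set.Ioi (0 : ℝ), HasDerivAt (fun x => Real.sinh x / (x * Real.cosh x))
      ((Real.cosh x * (x * Real.cosh x) - Real.sinh x * (1 * Real.cosh x + x * Real.sinh x))
        / (x * Real.cosh x) ^ 2) x := fun x hx =>
    (Real.hasDerivAt_sinh x).fun_div ((hasDerivAt_id x).fun_mul (Real.hasDerivAt_cosh x))
      (mul_pos hx (Real.cosh_pos x)).ne'
  refine antitoneOn_of_deriv_nonpos (convex_Ioi 0)
    (fun x hx => (hd x hx).continuousAt.continuousWithinAt) ?_ ?_
  · intro x hx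
    rw [interior_Ioi] at hx
    exact (hd x hx).differentiableAt.differentiableWithinAt
  · intro x hx
    rw [interior_Ioi] at hx
    rw [(hd x hx).deriv]
    refine div_nonpos_of_nonpos_of_nonneg ?_ (by positivity)
    have h1 := Real.self_le_sinh_iff.2 (le_of_lt hx)
    have h2 := Real.one_le_cosh x
    have h3 := Real.cosh_sq x
    have h0 : 0 < x := hx
    have h4 : x ≤ Real.sinh x * Real.cosh x := by nlinarith
    have h5 : Real.cosh x * (x * Real.cosh x)
        - Real.sinh x * (1 * Real.cosh x + x * Real.sinh x)
        = x - Real.sinh x * Real.cosh x := by linear_combination x * h3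
    linarith

/-- The tangent-line bound for the concave function `u ↦ log (cosh √u)` at `u = y ^ 2`. -/
theorem log_cosh_le_of_pos {x y : ℝ} (hx : 0 ≤ x) (hy : 0 < y) :
    Real.log (Real.cosh x) ≤ Real.log (Real.cosh y)
      + Real.sinh y / (y * Real.cosh y) / 2 * (x ^ 2 - y ^ 2) := by
  set T := Real.sinh y / (y * Real.cosh y) / 2 with hT
  let f : ℝ → ℝ := fun x => Real.log (Real.cosh y) + T * (x ^ 2 - y ^ 2) - Real.log (Real.cosh x)
  have hd : ∀ z, HasDerivAt f (T * (2 * z) - Real.sinh z / Real.cosh z) z := by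
    intro z
    have h1 : HasDerivAt (fun z : ℝ => Real.log (Real.cosh y) + T * (z ^ 2 - y ^ 2))
        (T * (2 * z)) z := by
      simpa using (((hasDerivAt_pow 2 z).sub_const (y ^ 2)).const_mul T).const_add
        (Real.log (Real.cosh y))
    exact h1.sub ((Real.hasDerivAt_cosh z).log (Real.cosh_pos z).ne')
  have hc : Continuous f := continuous_iff_continuousAt.2 fun z => (hd z).continuousAt
  have hfy : f y = 0 := by simp [f]
  have key : ∀ z, 0 < z → T * (2 * z) - Real.sinh z / Real.cosh z
      = z * (Real.sinh y / (y * Real.cosh y) - Real.sinh z / (z * Real.cosh z)) := by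
    intro z hz
    have := (Real.cosh_pos z).ne'
    rw [hT]
    field_simp
  suffices h : 0 ≤ f x by simp only [f] at h; linarith
  rcases le_total x y with hxy | hxy
  · have hanti : AntitoneOn f (Set.Icc 0 y) := by
      refine antitoneOn_of_deriv_nonpos (convex_Icc 0 y) hc.continuousOn
        (fun z _ => (hd z).differentiableAt.differentiableWithinAt) fun z hz => ?_
      rw [interior_Icc] at hz
      rw [(hd z).deriv, key z hz.1]
      have := antitoneOn_sinh_div_mul_cosh (Set.mem_Ioi.2 hz.1) (Set.mem_Ioi.2 hy) hz.2.le
      exact mul_nonpos_of_nonneg_of_nonpos hz.1.le (by simpa using this)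
    simpa [hfy] using hanti ⟨hx, hxy⟩ ⟨hy.le, le_rfl⟩ hxy
  · have hmono : MonotoneOn f (Set.Ici y) := by
      refine monotoneOn_of_deriv_nonneg (convex_Ici y) hc.continuousOn
        (fun z _ => (hd z).differentiableAt.differentiableWithinAt) fun z hz => ?_
      rw [interior_Ici] at hz
      have hz0 : 0 < z := hy.trans hz
      rw [(hd z).deriv, key z hz0]
      have := antitoneOn_sinh_div_mul_cosh (Set.mem_Ioi.2 hy) (Set.mem_Ioi.2 hz0) (le_of_lt hz)
      exact mul_nonneg hz0.le (by simpa using this)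
    simpa [hfy] using hmono (Set.mem_Ici.2 le_rfl) (Set.mem_Ici.2 hxy) hxy

theorem cosh_le_cosh_mul_exp (x : ℝ) {y : ℝ} (hy : y ≠ 0) :
    Real.cosh x ≤ Real.cosh y
      * Real.exp (Real.sinh y / (y * Real.cosh y) / 2 * (x ^ 2 - y ^ 2)) := by
  have h := log_cosh_le_of_pos (abs_nonneg x) (abs_pos.2 hy)
  have h1 : Real.sinh |y| / (|y| * Real.cosh |y|) = Real.sinh y / (y * Real.cosh y) := by
    rcases abs_choice y with h | h <;> rw [h]
    rw [Real.sinh_neg, Real.cosh_neg, neg_mul, neg_div_neg_eq]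
  rw [h1, Real.cosh_abs, Real.cosh_abs, sq_abs, sq_abs] at h
  have h2 := Real.exp_le_exp.2 h
  rwa [Real.exp_add, Real.exp_log (Real.cosh_pos x), Real.exp_log (Real.cosh_pos y)] at h2

/-- The Kearns–Saul bound on the moment generating function of a Bernoulli variable, with the
parameter `q = 1 / (1 + exp a)` written through its log-odds `-a ≠ 0`. -/
theorem bernoulli_mgf_le_of_logOdds {q a : ℝ} (ha : a ≠ 0) (hq : q = 1 / (1 + Real.exp a))
    (m : ℝ) :
    1 - q + q * Real.exp m ≤ Real.exp (m * q + (1 - 2 * q) / a * (m ^ 2 / 4)) := by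
  have hy : a / 2 ≠ 0 := by simpa using ha
  have h := cosh_le_cosh_mul_exp ((m - a) / 2) hy
  have hE : Real.exp a = Real.exp (a / 2) ^ 2 := by rw [← Real.exp_nat_mul]; congr 1; push_cast; ring
  have hM : Real.exp m = Real.exp (m / 2) ^ 2 := by rw [← Real.exp_nat_mul]; congr 1; push_cast; ring
  have hA := Real.exp_pos (a / 2)
  have hB := Real.exp_pos (m / 2)
  have hc := Real.cosh_pos (a / 2)
  have h1 : 1 - q + q * Real.exp m
      = Real.exp (m / 2) * Real.cosh ((m - a) / 2) / Real.cosh (a / 2) := by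
    rw [hq, Real.cosh_eq, Real.cosh_eq, hE, hM, show (m - a) / 2 = m / 2 - a / 2 by ring,
      Real.exp_neg, Real.exp_neg, Real.exp_sub]
    field_simp
    ring
  have h2 : Real.sinh (a / 2) / (a / 2 * Real.cosh (a / 2)) = 2 * (1 - 2 * q) / a := by
    rw [hq, Real.cosh_eq, Real.sinh_eq, hE, Real.exp_neg]
    field_simp
    ring
  rw [h1, div_le_iff₀ hc]
  rw [h2] at h
  refine (mul_le_mul_of_nonneg_left h hB.le).trans (le_of_eq ?_)
  rw [mul_left_comm, ← Real.exp_add, mul_comm]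
  congr 2
  field_simp
  ring

theorem concaveOn_log_one_sub_add_negMulLog :
    ConcaveOn ℝ (Set.Ico 0 1) fun q => Real.log (1 - q) + 2 * Real.negMulLog q := by
  refine ConcaveOn.add ?_ ((Real.concaveOn_negMulLog.subset (fun q hq => hq.1)
    (convex_Ico 0 1)).smul (by norm_num : (0 : ℝ) ≤ 2))
  have h := (strictConcaveOn_log_Ioi.concaveOn).comp_affineMap
    (AffineMap.const ℝ ℝ (1 : ℝ) - AffineMap.id ℝ ℝ)
  refine (h.subset ?_ (convex_Ico 0 1)).congr ?_
  · intro q hq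
    simpa using hq.2
  · intro q _
    simp

/-- Comparison of the Kearns–Saul constant with `-log q`: both `1 - 2 * q` and the log-odds
`log ((1 - q) / q)` change sign at `q = 1 / 2`, and the difference of the two sides does as well,
being concave in `q` with the zeros `0` and `1 / 2`. -/
theorem mul_one_sub_two_mul_div_logOdds_le {q w : ℝ} (hq0 : 0 < q) (hq1 : q < 1)
    (hq2 : q ≠ 1 / 2) (hw : 0 < w) (hwq : w ≤ -Real.log q) :
    (1 - 2 * q) / Real.log ((1 - q) / q) ≤ 1 / w := by
  have hc := concaveOn_log_one_sub_add_negMulLog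
  have hhalf : Real.log (1 - 1 / 2) + 2 * Real.negMulLog (1 / 2) = 0 := by
    rw [Real.negMulLog]; ring_nf
  have hlog : Real.log ((1 - q) / q) = Real.log (1 - q) - Real.log q :=
    Real.log_div (by linarith) hq0.ne'
  rcases lt_or_gt_of_ne hq2 with h | h
  · have ha : 0 < Real.log ((1 - q) / q) := Real.log_pos ((one_lt_div hq0).2 (by linarith))
    rw [div_le_div_iff₀ ha hw]
    have h1 := hc.2 (x := 0) (y := 1 / 2) (by simp) (by norm_num)
      (by linarith : 0 ≤ 1 - 2 * q) (by linarith : 0 ≤ 2 * q) (by ring)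
    simp only [smul_eq_mul, hhalf] at h1
    rw [show (1 - 2 * q) * 0 + 2 * q * (1 / 2) = q by ring] at h1
    simp only [sub_zero, Real.log_one, mul_zero, add_zero, Real.negMulLog] at h1
    rw [hlog]
    nlinarith
  · have ha : Real.log ((1 - q) / q) < 0 :=
      Real.log_neg (div_pos (by linarith) hq0) ((div_lt_one hq0).2 (by linarith))
    rw [div_le_iff_of_neg ha, ← mul_div_right_comm, div_le_iff₀ hw]
    -- `1 / 2` is the convex combination of `0` and `q` with weight `1 / (2 * q)` on `q`
    have h1 := hc.2 (x := 0) (y := q) (by simp) ⟨hq0.le, hq1⟩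
      (by rw [sub_nonneg, div_le_one (by linarith)]; linarith : 0 ≤ 1 - 1 / (2 * q))
      (by positivity : 0 ≤ 1 / (2 * q)) (by ring)
    simp only [smul_eq_mul] at h1
    rw [show (1 - 1 / (2 * q)) * 0 + 1 / (2 * q) * q = 1 / 2 by field_simp; ring, hhalf] at h1
    have h2 : Real.log (1 - q) + 2 * Real.negMulLog q ≤ 0 := by
      simp only [sub_zero, Real.log_one, Real.negMulLog_zero, mul_zero, add_zero, zero_add] at h1
      exact nonpos_of_mul_nonpos_right h1 (by positivity)
    rw [Real.negMulLog] at h2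
    rw [hlog]
    nlinarith

/-- A Bernoulli variable of parameter `q` is sub-Gaussian with variance factor `1 / (2 * w)` for
every `w ≤ -log q`. -/
theorem bernoulli_mgf_le {q w : ℝ} (hq0 : 0 < q) (hq1 : q < 1) (hw : 0 < w)
    (hwq : w ≤ -Real.log q) (m : ℝ) :
    1 - q + q * Real.exp m ≤ Real.exp (m * q + m ^ 2 / (4 * w)) := by
  by_cases hq2 : q = 1 / 2
  · have hM : Real.exp m = Real.exp (m / 2) ^ 2 := by
      rw [← Real.exp_nat_mul]; congr 1; push_cast; ring
    have h1 : 1 - q + q * Real.exp m = Real.exp (m / 2) * Real.cosh (m / 2) := by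
      rw [hq2, hM, Real.cosh_eq, Real.exp_neg]
      have := (Real.exp_pos (m / 2)).ne'
      field_simp
      ring
    rw [h1]
    refine (mul_le_mul_of_nonneg_left (Real.cosh_le_exp_half_sq _) (Real.exp_pos _).le).trans ?_
    rw [← Real.exp_add]
    refine Real.exp_le_exp.2 ?_
    have h2 : w ≤ 2 := by
      refine hwq.trans ?_
      rw [hq2, one_div, Real.log_inv, neg_neg]
      linarith [Real.log_two_lt_d9]
    have h3 : m ^ 2 / 8 ≤ m ^ 2 / (4 * w) := by gcongr; linarith
    rw [hq2]
    linarith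
  · have ha : Real.log ((1 - q) / q) ≠ 0 := by
      refine Real.log_ne_zero_of_pos_of_ne_one (div_pos (by linarith) hq0) fun h => hq2 ?_
      rw [div_eq_one_iff_eq hq0.ne'] at h
      linarith
    refine (bernoulli_mgf_le_of_logOdds ha ?_ m).trans (Real.exp_le_exp.2 ?_)
    · rw [Real.exp_log (div_pos (by linarith) hq0)]
      field_simp
      ring
    · have := mul_le_mul_of_nonneg_right (mul_one_sub_two_mul_div_logOdds_le hq0 hq1 hq2 hw hwq)
        (by positivity : 0 ≤ m ^ 2 / 4)
      have h2 : 1 / w * (m ^ 2 / 4) = m ^ 2 / (4 * w) := by field_simp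
      linarith

theorem exp_neg_le_quadratic {x : ℝ} (hx : 0 ≤ x) : Real.exp (-x) ≤ 1 - x + x ^ 2 / 2 := by
  have h := Real.quadratic_le_exp_of_nonneg hx
  rw [Real.exp_neg, inv_le_iff_one_le_mul₀ (Real.exp_pos x)]
  nlinarith [sq_nonneg (x - 1), sq_nonneg (x ^ 2)]

/-- One-sided bound for a Bernoulli variable: its negative exponential moments are controlled by
its second moment `q`. -/
theorem bernoulli_mgf_neg_le {q x : ℝ} (hq : 0 ≤ q) (hx : 0 ≤ x) :
    1 - q + q * Real.exp (-x) ≤ Real.exp (-x * q + x ^ 2 * q / 2) := by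
  refine le_trans ?_ (Real.add_one_le_exp _)
  nlinarith [mul_le_mul_of_nonneg_left (exp_neg_le_quadratic hx) hq]

theorem mul_one_sub_pow_le {p : ℝ} (hp0 : 0 ≤ p) (hp1 : p ≤ 1) {n : ℕ} (hn : 0 < n) :
    p * (1 - p) ^ n ≤ 1 / (n * Real.exp 1) := by
  have h1 : (1 - p) ^ n ≤ Real.exp (-(n * p)) := by
    rw [← mul_neg, Real.exp_nat_mul]
    exact pow_le_pow_left₀ (by linarith) (Real.one_sub_le_exp_neg p) n
  have h2 := Real.mul_exp_neg_le_exp_neg_one (n * p)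
  have hn' : (0 : ℝ) < n := by exact_mod_cast hn
  calc p * (1 - p) ^ n ≤ p * Real.exp (-(n * p)) := by gcongr
    _ = (n * p * Real.exp (-(n * p))) / n := by field_simp
    _ ≤ Real.exp (-1) / n := by gcongr
    _ = 1 / (n * Real.exp 1) := by rw [Real.exp_neg]; field_simp

/-! ### Occupancy indicators and their negative dependence -/

open Classical in
/-- The indicator that the letter `a` does not occur among the `X i`, `i ∈ I`. -/
noncomputable def unseen {Ω A ι : Type*} (X : ι → Ω → A) (I : Finset ι) (a : A) (ω : Ω) : ℝ :=
  if ∀ i ∈ I, X i ω ≠ a then 1 else 0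

section Unseen

variable {Ω A ι : Type*} {X : ι → Ω → A}

theorem unseen_eq_zero_or_one (I : Finset ι) (a : A) (ω : Ω) :
    unseen X I a ω = 0 ∨ unseen X I a ω = 1 := by
  unfold unseen
  split_ifs <;> simp

theorem unseen_nonneg (I : Finset ι) (a : A) (ω : Ω) : 0 ≤ unseen X I a ω := by
  rcases unseen_eq_zero_or_one (X := X) I a ω with h | h <;> simp [h]

theorem unseen_le_one (I : Finset ι) (a : A) (ω : Ω) : unseen X I a ω ≤ 1 := by
  rcases unseen_eq_zero_or_one (X := X) I a ω with h | h <;> simp [h]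

theorem measurable_unseen [MeasurableSpace Ω] [MeasurableSpace A] [DiscreteMeasurableSpace A]
    (hX : ∀ i, Measurable (X i)) (I : Finset ι) (a : A) : Measurable (unseen X I a) := by
  classical
  refine Measurable.ite ?_ measurable_const measurable_const
  have : {ω | ∀ i ∈ I, X i ω ≠ a} = ⋂ i ∈ I, X i ⁻¹' {a}ᶜ := by
    ext; simp
  rw [this]
  exact Finset.measurableSet_biInter I fun i _ => hX i (MeasurableSet.of_discrete)

theorem exp_mul_unseen (I : Finset ι) (a : A) (ω : Ω) (l : ℝ) :
    Real.exp (l * unseen X I a ω) = 1 - (1 - Real.exp l) * unseen X I a ω := by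
  rcases unseen_eq_zero_or_one (X := X) I a ω with h | h <;> simp [h]

/-- Conditioning on one more letter: if it equals `s ∈ S`, then `s` has been seen, which amounts
to replacing the coefficient of `s` by `0`. -/
theorem prod_one_sub_unseen_insert [DecidableEq ι] [DecidableEq A] {I : Finset ι} {j : ι}
    (S : Finset A) (c : A → ℝ) (ω : Ω) :
    ∏ a ∈ S, (1 - c a * unseen X (insert j I) a ω)
      = (1 - ∑ s ∈ S, (if X j ω = s then (1 : ℝ) else 0)) * ∏ a ∈ S, (1 - c a * unseen X I a ω)
        + ∑ s ∈ S, (if X j ω = s then (1 : ℝ) else 0)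
          * ∏ a ∈ S, (1 - Function.update c s 0 a * unseen X I a ω) := by
  have h : ∀ a, unseen X (insert j I) a ω = if X j ω = a then 0 else unseen X I a ω := by
    intro a
    unfold unseen
    by_cases ha : X j ω = a <;> simp [ha]
  simp_rw [h, ite_mul, one_mul, zero_mul, Finset.sum_ite_eq]
  by_cases hj : X j ω ∈ S
  · simp only [hj, if_true, sub_self, zero_mul, zero_add]
    refine Finset.prod_congr rfl fun a _ => ?_
    by_cases ha : a = X j ω
    · simp [ha]
    · simp [ha, Ne.symm ha]
  · simp only [hj, if_false, sub_zero, one_mul, add_zero]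
    refine Finset.prod_congr rfl fun a ha => ?_
    rw [if_neg (fun hja => hj (by rwa [hja]))]

theorem integral_ite_mul_prod_unseen [MeasurableSpace Ω] [MeasurableSpace A]
    [DiscreteMeasurableSpace A] [DecidableEq A] {μ : Measure Ω}
    [IsProbabilityMeasure μ] (hX : ∀ i, Measurable (X i)) (hindep : iIndepFun X μ)
    {I : Finset ι} {j : ι} (hj : j ∉ I) (S : Finset A) (c : A → ℝ) (s : A) :
    ∫ ω, (if X j ω = s then (1 : ℝ) else 0) * ∏ a ∈ S, (1 - c a * unseen X I a ω) ∂μ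
      = μ.real {ω | X j ω = s} * ∫ ω, ∏ a ∈ S, (1 - c a * unseen X I a ω) ∂μ := by
  classical
  have h := hindep.indepFun_finset {j} I (by simpa using hj) hX
  let f : (({j} : Finset ι) → A) → ℝ := fun x => if x ⟨j, by simp⟩ = s then 1 else 0
  let g : (I → A) → ℝ := fun x => ∏ a ∈ S, (1 - c a * if ∀ i, x i ≠ a then 1 else 0)
  have hj' : Measurable fun x : ({j} : Finset ι) → A => x ⟨j, by simp⟩ := measurable_pi_apply _
  have hf : Measurable f := Measurable.ite (hj' (MeasurableSet.of_discrete (s := {s})))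
    measurable_const measurable_const
  have hg : Measurable g := by
    refine Finset.measurable_prod _ fun a _ => measurable_const.sub (measurable_const.mul ?_)
    refine Measurable.ite ?_ measurable_const measurable_const
    have : {x : I → A | ∀ i, x i ≠ a} = ⋂ i, (fun x => x i) ⁻¹' {a}ᶜ := by ext; simp
    rw [this]
    exact MeasurableSet.iInter fun i => measurable_pi_apply i MeasurableSet.of_discrete
  have hfg := h.comp hf hg
  have hm : ∀ T : Finset ι, Measurable fun ω => fun i : T => X i ω := fun T =>
    measurable_pi_lambda _ fun i => hX i
  have key := hfg.integral_fun_mul_eq_mul_integral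
    (hf.comp (hm _)).aestronglyMeasurable (hg.comp (hm _)).aestronglyMeasurable
  have h1 : ∀ ω, (g ∘ fun ω => fun i : I => X i ω) ω = ∏ a ∈ S, (1 - c a * unseen X I a ω) := by
    intro ω
    refine Finset.prod_congr rfl fun a _ => ?_
    have : (∀ i : I, X i ω ≠ a) ↔ ∀ i ∈ I, X i ω ≠ a := Subtype.forall
    unfold unseen
    by_cases ha : ∀ i ∈ I, X i ω ≠ a
    · rw [if_pos ha, if_pos (this.2 ha)]
    · rw [if_neg ha, if_neg (this.not.2 ha)]
  have h2 : ∀ ω, (f ∘ fun ω => fun i : ({j} : Finset ι) => X i ω) ω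
      = if X j ω = s then (1 : ℝ) else 0 := fun ω => rfl
  simp_rw [h1, h2] at key
  rw [key]
  congr 1
  have h3 : (fun ω => if X j ω = s then (1 : ℝ) else 0)
      = {ω | X j ω = s}.indicator fun _ => 1 := by
    ext ω
    simp [Set.indicator_apply]
  have h4 : MeasurableSet {ω | X j ω = s} := hX j (MeasurableSet.of_discrete (s := {s}))
  rw [h3, integral_indicator_const _ h4]
  simp

theorem integrable_prod_one_sub_unseen [MeasurableSpace Ω] [MeasurableSpace A]
    [DiscreteMeasurableSpace A] {μ : Measure Ω} [IsFiniteMeasure μ]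
    (hX : ∀ i, Measurable (X i)) (I : Finset ι) (S : Finset A) (c : A → ℝ) :
    Integrable (fun ω => ∏ a ∈ S, (1 - c a * unseen X I a ω)) μ := by
  refine Integrable.of_bound (C := ∏ a ∈ S, (1 + |c a|))
    (Finset.measurable_prod _ fun a _ => measurable_const.sub
      (measurable_const.mul (measurable_unseen hX I a))).aestronglyMeasurable
    (Filter.Eventually.of_forall fun ω => ?_)
  rw [Real.norm_eq_abs, Finset.abs_prod]
  refine Finset.prod_le_prod (fun _ _ => abs_nonneg _) fun a _ => ?_
  refine (abs_sub _ _).trans ?_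
  rw [abs_one, abs_mul, abs_of_nonneg (unseen_nonneg I a ω)]
  gcongr
  exact mul_le_of_le_one_right (abs_nonneg _) (unseen_le_one I a ω)

/-- The occupancy indicators are negatively dependent: the expectation of a product of affine
functions of them, all increasing or all decreasing, is at most the product it would be if they
were independent. -/
theorem integral_prod_one_sub_unseen_le [MeasurableSpace Ω] [MeasurableSpace A]
    [DiscreteMeasurableSpace A] {μ : Measure Ω} [IsProbabilityMeasure μ]
    (hX : ∀ i, Measurable (X i)) (hindep : iIndepFun X μ) {p : A → ℝ}
    (hlaw : ∀ i a, μ.real {ω | X i ω = a} = p a) (hp0 : ∀ a, 0 ≤ p a)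
    (S : Finset A) (hp1 : ∑ a ∈ S, p a ≤ 1) (hpa : ∀ a, p a ≤ 1)
    (I : Finset ι) (c : A → ℝ) (hc : (∀ a, 0 ≤ c a ∧ c a < 1) ∨ ∀ a, c a ≤ 0) :
    ∫ ω, ∏ a ∈ S, (1 - c a * unseen X I a ω) ∂μ ≤ ∏ a ∈ S, (1 - c a * (1 - p a) ^ I.card) := by
  classical
  induction I using Finset.induction_on generalizing c with
  | empty => simp [unseen]
  | insert j I hj ih =>
    have hq0 : ∀ a, 0 ≤ (1 - p a) ^ I.card := fun a => pow_nonneg (by linarith [hpa a]) _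
    have hq1 : ∀ a, (1 - p a) ^ I.card ≤ 1 := fun a =>
      pow_le_one₀ (by linarith [hpa a]) (by linarith [hp0 a])
    have hpos : ∀ a, 0 < 1 - c a * (1 - p a) ^ I.card := by
      intro a
      rcases hc with hc | hc
      · nlinarith [hc a, hq0 a, hq1 a]
      · nlinarith [hc a, hq0 a]
    have hupd : ∀ s, (∀ a, 0 ≤ Function.update c s 0 a ∧ Function.update c s 0 a < 1)
        ∨ ∀ a, Function.update c s 0 a ≤ 0 := by
      intro s
      refine hc.imp (fun h a => ?_) (fun h a => ?_) <;> by_cases ha : a = s <;> simp [ha, h]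
    have hint := fun c => integrable_prod_one_sub_unseen (μ := μ) hX I S c
    have hite : ∀ (s : A) (c : A → ℝ), Integrable (fun ω => (if X j ω = s then (1 : ℝ) else 0)
        * ∏ a ∈ S, (1 - c a * unseen X I a ω)) μ := by
      intro s c
      refine (hint c).bdd_mul (c := 1) ?_ (Filter.Eventually.of_forall fun ω => ?_)
      · exact (Measurable.ite (hX j (MeasurableSet.of_discrete (s := {s})))
          measurable_const measurable_const).aestronglyMeasurable
      · split_ifs <;> simp
    have hstep : ∫ ω, ∏ a ∈ S, (1 - c a * unseen X (insert j I) a ω) ∂μ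
        = (1 - ∑ s ∈ S, p s) * ∫ ω, ∏ a ∈ S, (1 - c a * unseen X I a ω) ∂μ
          + ∑ s ∈ S, p s
            * ∫ ω, ∏ a ∈ S, (1 - Function.update c s 0 a * unseen X I a ω) ∂μ := by
      have h1 := integrable_finsetSum S fun s _ => hite s c
      have h2 := integrable_finsetSum S fun s _ => hite s (Function.update c s 0)
      simp_rw [prod_one_sub_unseen_insert, sub_mul, one_mul, Finset.sum_mul]
      refine (integral_add ((hint c).sub h1) h2).trans ?_
      congr 1
      · refine (integral_sub (hint c) h1).trans ?_
        rw [integral_finsetSum _ fun s _ => hite s c]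
        simp_rw [integral_ite_mul_prod_unseen hX hindep hj, hlaw]
      · rw [integral_finsetSum _ fun s _ => hite s _]
        simp_rw [integral_ite_mul_prod_unseen hX hindep hj, hlaw]
    rw [hstep, Finset.card_insert_of_notMem hj]
    set Q := ∏ a ∈ S, (1 - c a * (1 - p a) ^ I.card) with hQ
    have hQpos : 0 < Q := Finset.prod_pos fun a _ => hpos a
    -- relative increment of the factor of `a` when `I` grows by one element
    let x : A → ℝ := fun a =>
      p a * (c a * (1 - p a) ^ I.card) / (1 - c a * (1 - p a) ^ I.card)
    have hx : (∀ a, 0 ≤ x a) ∨ ∀ a, -1 ≤ x a ∧ x a ≤ 0 := by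
      refine hc.imp (fun h a => ?_) (fun h a => ?_)
      · exact div_nonneg (mul_nonneg (hp0 a) (mul_nonneg (h a).1 (hq0 a))) (hpos a).le
      · have h1 : c a * (1 - p a) ^ I.card ≤ 0 := mul_nonpos_of_nonpos_of_nonneg (h a) (hq0 a)
        constructor
        · rw [le_div_iff₀ (hpos a)]
          nlinarith [hp0 a, hpa a]
        · exact div_nonpos_of_nonpos_of_nonneg (mul_nonpos_of_nonneg_of_nonpos (hp0 a) h1)
            (hpos a).le
    have herase : ∀ s ∈ S, ∏ a ∈ S, (1 - Function.update c s 0 a * (1 - p a) ^ I.card)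
        = Q / (1 - c s * (1 - p s) ^ I.card) := by
      intro s hs
      rw [eq_div_iff (hpos s).ne', hQ, ← Finset.prod_erase_mul S _ hs,
        ← Finset.prod_erase_mul S (fun a => 1 - c a * (1 - p a) ^ I.card) hs]
      simp only [Function.update_self, zero_mul, sub_zero, mul_one]
      congr 1
      refine Finset.prod_congr rfl fun a ha => ?_
      rw [Function.update_of_ne (Finset.ne_of_mem_erase ha)]
    calc (1 - ∑ s ∈ S, p s) * ∫ ω, ∏ a ∈ S, (1 - c a * unseen X I a ω) ∂μ
          + ∑ s ∈ S, p s * ∫ ω, ∏ a ∈ S, (1 - Function.update c s 0 a * unseen X I a ω) ∂μ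
        ≤ (1 - ∑ s ∈ S, p s) * Q + ∑ s ∈ S, p s * (Q / (1 - c s * (1 - p s) ^ I.card)) := by
          refine add_le_add (mul_le_mul_of_nonneg_left (ih c hc) (by linarith))
            (Finset.sum_le_sum fun s hs => mul_le_mul_of_nonneg_left ?_ (hp0 s))
          exact (ih _ (hupd s)).trans (herase s hs).le
      _ = Q * (1 + ∑ s ∈ S, x s) := by
          rw [sub_mul, one_mul, Finset.sum_mul, mul_add, mul_one, Finset.mul_sum, sub_add,
            ← Finset.sum_sub_distrib, sub_eq_add_neg, ← Finset.sum_neg_distrib]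
          congr 1
          refine Finset.sum_congr rfl fun s _ => ?_
          have := (hpos s).ne'
          simp only [x]
          field_simp
          ring
      _ ≤ Q * ∏ a ∈ S, (1 + x a) := by
          gcongr
          exact one_add_sum_le_prod_one_add_of_same_sign S x hx
      _ = ∏ a ∈ S, (1 - c a * (1 - p a) ^ (I.card + 1)) := by
          rw [hQ, ← Finset.prod_mul_distrib]
          refine Finset.prod_congr rfl fun a _ => ?_
          have := (hpos a).ne'
          simp only [x]
          field_simp
          ring

end Unseen

/-! ### Concentration of the missing mass -/

section Summability

variable {Ω A ι : Type*} {X : ι → Ω → A} {p : A → ℝ}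

theorem summable_mul_unseen (hp0 : ∀ a, 0 ≤ p a) (hp : HasSum p 1) (I : Finset ι) (ω : Ω) :
    Summable fun a => p a * unseen X I a ω :=
  hp.summable.of_nonneg_of_le (fun a => mul_nonneg (hp0 a) (unseen_nonneg I a ω))
    fun a => mul_le_of_le_one_right (hp0 a) (unseen_le_one I a ω)

theorem summable_mul_one_sub_pow (hp0 : ∀ a, 0 ≤ p a) (hp : HasSum p 1) (n : ℕ) :
    Summable fun a => p a * (1 - p a) ^ n := by
  have hpa : ∀ a, p a ≤ 1 := fun a => le_hasSum hp a fun b _ => hp0 b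
  exact hp.summable.of_nonneg_of_le
    (fun a => mul_nonneg (hp0 a) (pow_nonneg (by linarith [hpa a]) _))
    fun a => mul_le_of_le_one_right (hp0 a)
      (pow_le_one₀ (by linarith [hpa a]) (by linarith [hp0 a]))

theorem exp_mul_le_exp_abs {x : ℝ} (hx0 : 0 ≤ x) (hx1 : x ≤ 1) (l : ℝ) :
    Real.exp (l * x) ≤ Real.exp |l| := by
  refine Real.exp_le_exp.2 ((le_abs_self _).trans ?_)
  rw [abs_mul, abs_of_nonneg hx0]
  exact mul_le_of_le_one_right (abs_nonneg _) hx1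

end Summability

section Concentration

variable {Ω A ι : Type*} {X : ι → Ω → A} [MeasurableSpace Ω] [MeasurableSpace A]
  [DiscreteMeasurableSpace A] {μ : Measure Ω} [IsProbabilityMeasure μ] {p : A → ℝ}

theorem integral_exp_sum_unseen_le (hX : ∀ i, Measurable (X i)) (hindep : iIndepFun X μ)
    (hlaw : ∀ i a, μ.real {ω | X i ω = a} = p a) (hp0 : ∀ a, 0 ≤ p a) (hp : HasSum p 1)
    (I : Finset ι) (l : ℝ) (S : Finset A) :
    ∫ ω, Real.exp (l * ∑ a ∈ S, p a * unseen X I a ω) ∂μ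
      ≤ ∏ a ∈ S, (1 - (1 - p a) ^ I.card + (1 - p a) ^ I.card * Real.exp (l * p a)) := by
  have hpa : ∀ a, p a ≤ 1 := fun a => le_hasSum hp a fun b _ => hp0 b
  have hS : ∑ a ∈ S, p a ≤ 1 := sum_le_hasSum S (fun b _ => hp0 b) hp
  have h := integral_prod_one_sub_unseen_le hX hindep hlaw hp0 S hS hpa I
    (fun a => 1 - Real.exp (l * p a)) (by
      rcases le_total l 0 with hl | hl
      · refine Or.inl fun a => ⟨?_, by linarith [Real.exp_pos (l * p a)]⟩
        linarith [Real.exp_le_one_iff.2 (mul_nonpos_of_nonpos_of_nonneg hl (hp0 a))]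
      · refine Or.inr fun a => ?_
        linarith [Real.one_le_exp (mul_nonneg hl (hp0 a))])
  refine le_trans (le_of_eq ?_) (h.trans (le_of_eq ?_))
  · congr 1 with ω
    rw [Finset.mul_sum, Real.exp_sum]
    refine Finset.prod_congr rfl fun a _ => ?_
    rw [← mul_assoc, exp_mul_unseen]
  · exact Finset.prod_congr rfl fun a _ => by ring

theorem measurable_tsum_unseen [Countable A] (hX : ∀ i, Measurable (X i)) (hp0 : ∀ a, 0 ≤ p a)
    (hp : HasSum p 1) (I : Finset ι) : Measurable fun ω => ∑' a, p a * unseen X I a ω :=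
  measurable_of_tendsto_metrizable' (Filter.atTop (α := Finset A))
    (fun S => Finset.measurable_sum S fun a _ => (measurable_unseen hX I a).const_mul (p a))
    (tendsto_pi_nhds.2 fun ω => by
      simpa [HasSum] using (summable_mul_unseen (X := X) hp0 hp I ω).hasSum)

/-- A bound on the centred moment generating function of the missing mass, from bounds on the
factors corresponding to the single letters. -/
theorem mgf_tsum_unseen_le [Countable A] (hX : ∀ i, Measurable (X i)) (hindep : iIndepFun X μ)
    (hlaw : ∀ i a, μ.real {ω | X i ω = a} = p a) (hp0 : ∀ a, 0 ≤ p a) (hp : HasSum p 1)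
    (I : Finset ι) {l v : ℝ} (hv : 0 ≤ v)
    (hfac : ∀ a, 1 - (1 - p a) ^ I.card + (1 - p a) ^ I.card * Real.exp (l * p a)
      ≤ Real.exp (l * (p a * (1 - p a) ^ I.card) + v * p a)) :
    mgf (fun ω => ∑' a, p a * unseen X I a ω) μ l
      ≤ Real.exp (l * ∑' a, p a * (1 - p a) ^ I.card + v) := by
  have hpa : ∀ a, p a ≤ 1 := fun a => le_hasSum hp a fun b _ => hp0 b
  have hq0 : ∀ a, 0 ≤ (1 - p a) ^ I.card := fun a => pow_nonneg (by linarith [hpa a]) _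
  have hq1 : ∀ a, (1 - p a) ^ I.card ≤ 1 := fun a =>
    pow_le_one₀ (by linarith [hpa a]) (by linarith [hp0 a])
  have hfin : ∀ S : Finset A, ∫ ω, Real.exp (l * ∑ a ∈ S, p a * unseen X I a ω) ∂μ
      ≤ Real.exp (l * ∑ a ∈ S, p a * (1 - p a) ^ I.card + v) := by
    intro S
    refine (integral_exp_sum_unseen_le hX hindep hlaw hp0 hp I l S).trans ?_
    refine (Finset.prod_le_prod (fun a _ => ?_) fun a _ => hfac a).trans ?_
    · have := mul_nonneg (hq0 a) (Real.exp_pos (l * p a)).le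
      linarith [hq1 a]
    · rw [← Real.exp_sum, Finset.sum_add_distrib, ← Finset.mul_sum, ← Finset.mul_sum]
      refine Real.exp_le_exp.2 ?_
      have := mul_le_of_le_one_right hv (sum_le_hasSum S (fun b _ => hp0 b) hp)
      linarith
  have hleft : Filter.Tendsto
      (fun S : Finset A => ∫ ω, Real.exp (l * ∑ a ∈ S, p a * unseen X I a ω) ∂μ) Filter.atTop
      (nhds (mgf (fun ω => ∑' a, p a * unseen X I a ω) μ l)) := by
    refine tendsto_integral_filter_of_dominated_convergence (fun _ => Real.exp |l|)
      (Filter.Eventually.of_forall fun S => ?_) (Filter.Eventually.of_forall fun S =>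
        Filter.Eventually.of_forall fun ω => ?_) (integrable_const _)
      (Filter.Eventually.of_forall fun ω => ?_)
    · exact (Real.measurable_exp.comp ((Finset.measurable_sum S fun a _ =>
        (measurable_unseen hX I a).const_mul (p a)).const_mul l)).aestronglyMeasurable
    · have h0 : 0 ≤ ∑ a ∈ S, p a * unseen X I a ω :=
        Finset.sum_nonneg fun a _ => mul_nonneg (hp0 a) (unseen_nonneg I a ω)
      have h1 : ∑ a ∈ S, p a * unseen X I a ω ≤ 1 :=
        (Finset.sum_le_sum fun a _ => mul_le_of_le_one_right (hp0 a)
          (unseen_le_one I a ω)).trans (sum_le_hasSum S (fun b _ => hp0 b) hp)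
      rw [Real.norm_eq_abs, Real.abs_exp]
      exact exp_mul_le_exp_abs h0 h1 l
    · have h : Filter.Tendsto (fun S : Finset A => ∑ a ∈ S, p a * unseen X I a ω) Filter.atTop
          (nhds (∑' a, p a * unseen X I a ω)) := by
        simpa [HasSum] using (summable_mul_unseen (X := X) hp0 hp I ω).hasSum
      exact (Real.continuous_exp.tendsto _).comp (h.const_mul l)
  have hright : Filter.Tendsto
      (fun S : Finset A => Real.exp (l * ∑ a ∈ S, p a * (1 - p a) ^ I.card + v)) Filter.atTop
      (nhds (Real.exp (l * ∑' a, p a * (1 - p a) ^ I.card + v))) := by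
    have h : Filter.Tendsto (fun S : Finset A => ∑ a ∈ S, p a * (1 - p a) ^ I.card) Filter.atTop
        (nhds (∑' a, p a * (1 - p a) ^ I.card)) := by
      simpa [HasSum] using (summable_mul_one_sub_pow hp0 hp I.card).hasSum
    exact (Real.continuous_exp.tendsto _).comp ((h.const_mul l).add_const v)
  exact le_of_tendsto_of_tendsto' hleft hright hfin

theorem integrable_exp_mul_tsum_unseen [Countable A] (hX : ∀ i, Measurable (X i))
    (hp0 : ∀ a, 0 ≤ p a) (hp : HasSum p 1) (I : Finset ι) (l : ℝ) :
    Integrable (fun ω => Real.exp (l * ∑' a, p a * unseen X I a ω)) μ :=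
  Integrable.of_bound
    (Real.measurable_exp.comp ((measurable_tsum_unseen hX hp0 hp I).const_mul
      l)).aestronglyMeasurable (Real.exp |l|) (Filter.Eventually.of_forall fun ω => by
        rw [Real.norm_eq_abs, Real.abs_exp]
        refine exp_mul_le_exp_abs
          (tsum_nonneg fun a => mul_nonneg (hp0 a) (unseen_nonneg I a ω)) ?_ l
        exact hasSum_le (fun a => mul_le_of_le_one_right (hp0 a) (unseen_le_one I a ω))
          (summable_mul_unseen hp0 hp I ω).hasSum hp)

/-- The lower tail of the missing mass is sub-Gaussian with variance factor `1 / (n e)`. -/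
theorem measure_tsum_unseen_le_sub_le [Countable A] (hX : ∀ i, Measurable (X i))
    (hindep : iIndepFun X μ) (hlaw : ∀ i a, μ.real {ω | X i ω = a} = p a)
    (hp0 : ∀ a, 0 ≤ p a) (hp : HasSum p 1) {I : Finset ι} (hI : I.Nonempty)
    {t : ℝ} (ht : 0 ≤ t) :
    μ.real {ω | ∑' a, p a * unseen X I a ω
      ≤ ∑' a, p a * (1 - p a) ^ I.card - √(2 * t / (I.card * Real.exp 1))} ≤ Real.exp (-t) := by
  have hpa : ∀ a, p a ≤ 1 := fun a => le_hasSum hp a fun b _ => hp0 b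
  have hn : 0 < I.card := hI.card_pos
  set N : ℝ := I.card * Real.exp 1 with hN
  have hNpos : 0 < N := mul_pos (by exact_mod_cast hn) (Real.exp_pos 1)
  set s := √(2 * t / N) with hs
  have hs0 : 0 ≤ s := Real.sqrt_nonneg _
  have hs2 : s ^ 2 = 2 * t / N := Real.sq_sqrt (by positivity)
  -- the optimal exponent in Chernoff's bound is `N * s`
  have hmgf := mgf_tsum_unseen_le (l := -(N * s)) (v := (N * s) ^ 2 / (2 * N)) hX hindep hlaw hp0
    hp I (by positivity) (by
      intro a
      have h1 := bernoulli_mgf_neg_le (q := (1 - p a) ^ I.card)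
        (pow_nonneg (by linarith [hpa a]) _) (mul_nonneg (mul_nonneg hNpos.le hs0) (hp0 a))
      rw [← neg_mul] at h1
      refine h1.trans (Real.exp_le_exp.2 ?_)
      have h2 := mul_one_sub_pow_le (hp0 a) (hpa a) hn
      rw [← hN] at h2
      have h3 := mul_le_mul_of_nonneg_left h2
        (mul_nonneg (by positivity : 0 ≤ (N * s) ^ 2 / 2) (hp0 a))
      have h4 : (N * s) ^ 2 / 2 * p a * (1 / N) = (N * s) ^ 2 / (2 * N) * p a := by
        field_simp
      nlinarith)
  refine (measure_le_le_exp_mul_mgf _ (neg_nonpos.2 (by positivity : 0 ≤ N * s))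
    (integrable_exp_mul_tsum_unseen hX hp0 hp I _)).trans ?_
  refine (mul_le_mul_of_nonneg_left hmgf (Real.exp_pos _).le).trans ?_
  rw [← Real.exp_add]
  refine Real.exp_le_exp.2 (le_of_eq ?_)
  have h5 : (N * s) ^ 2 / (2 * N) = t := by rw [mul_pow, hs2]; field_simp
  have h6 : N * s * s = 2 * t := by rw [mul_assoc, ← sq, hs2]; field_simp
  rw [h5]
  linear_combination -h6

/-- The upper tail of the missing mass is sub-Gaussian with variance factor `1 / (2 n)`. -/
theorem measure_add_le_tsum_unseen_le [Countable A] (hX : ∀ i, Measurable (X i))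
    (hindep : iIndepFun X μ) (hlaw : ∀ i a, μ.real {ω | X i ω = a} = p a)
    (hp0 : ∀ a, 0 < p a) (hp1 : ∀ a, p a < 1) (hp : HasSum p 1) {I : Finset ι} (hI : I.Nonempty)
    {t : ℝ} (ht : 0 ≤ t) :
    μ.real {ω | ∑' a, p a * (1 - p a) ^ I.card + √(t / I.card)
      ≤ ∑' a, p a * unseen X I a ω} ≤ Real.exp (-t) := by
  have hn : 0 < I.card := hI.card_pos
  set n : ℝ := (I.card : ℝ) with hn_def
  have hnpos : 0 < n := by rw [hn_def]; exact_mod_cast hn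
  set s := √(t / n) with hs
  have hs0 : 0 ≤ s := Real.sqrt_nonneg _
  have hs2 : s ^ 2 = t / n := Real.sq_sqrt (by positivity)
  -- the optimal exponent in Chernoff's bound is `2 * n * s`
  have hmgf := mgf_tsum_unseen_le (l := 2 * n * s) (v := (2 * n * s) ^ 2 / (4 * n)) hX hindep hlaw
    (fun a => (hp0 a).le) hp I (by positivity) (by
      intro a
      have h1 := bernoulli_mgf_le (q := (1 - p a) ^ I.card) (w := n * p a)
        (pow_pos (by linarith [hp1 a]) _)
        (pow_lt_one₀ (by linarith [hp1 a]) (by linarith [hp0 a]) hn.ne')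
        (mul_pos hnpos (hp0 a)) (by
          rw [Real.log_pow, ← mul_neg]
          refine mul_le_mul_of_nonneg_left ?_ hnpos.le
          linarith [Real.log_le_sub_one_of_pos (by linarith [hp1 a] : 0 < 1 - p a)])
        (2 * n * s * p a)
      refine h1.trans (le_of_eq ?_)
      have := (hp0 a).ne'
      congr 1
      field_simp)
  refine (measure_ge_le_exp_mul_mgf _ (by positivity : 0 ≤ 2 * n * s)
    (integrable_exp_mul_tsum_unseen hX (fun a => (hp0 a).le) hp I _)).trans ?_
  refine (mul_le_mul_of_nonneg_left hmgf (Real.exp_pos _).le).trans ?_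
  rw [← Real.exp_add]
  refine Real.exp_le_exp.2 (le_of_eq ?_)
  have h5 : (2 * n * s) ^ 2 / (4 * n) = t := by rw [mul_pow, hs2]; field_simp; ring
  have h6 : n * s * s = t := by rw [mul_assoc, ← sq, hs2]; field_simp
  rw [h5]
  linear_combination -2 * h6

end Concentration

/-! ### The incomplete Gamma function -/

theorem intervalIntegrable_lowerGamma {α : ℝ} (hα1 : α < 1) (x : ℝ) :
    IntervalIntegrable (fun u : ℝ => u ^ (1 - α - 1) * Real.exp (-u)) volume 0 x :=
  (intervalIntegral.intervalIntegrable_rpow' (by linarith)).mul_continuousOn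
    (by fun_prop)

theorem integral_rpow_one_sub_sub_one {α : ℝ} (hα1 : α < 1) (x : ℝ) :
    ∫ u in (0 : ℝ)..x, u ^ (1 - α - 1) = x ^ (1 - α) / (1 - α) := by
  rw [integral_rpow (Or.inl (by linarith)), sub_add_cancel, Real.zero_rpow (by linarith), sub_zero]

theorem lowerGamma_le {α x : ℝ} (hα1 : α < 1) (hx : 0 ≤ x) :
    lowerGamma (1 - α) x ≤ x ^ (1 - α) / (1 - α) := by
  rw [← integral_rpow_one_sub_sub_one hα1, lowerGamma]
  refine intervalIntegral.integral_mono_on hx (intervalIntegrable_lowerGamma hα1 x)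
    (intervalIntegral.intervalIntegrable_rpow' (by linarith)) fun u hu => ?_
  exact mul_le_of_le_one_right (Real.rpow_nonneg hu.1 _)
    (Real.exp_le_one_iff.2 (by linarith [hu.1]))

theorem le_lowerGamma {α x : ℝ} (hα1 : α < 1) (hx : 0 ≤ x) :
    x ^ (1 - α) / (1 - α) * Real.exp (-x) ≤ lowerGamma (1 - α) x := by
  rw [← integral_rpow_one_sub_sub_one hα1, lowerGamma, ← intervalIntegral.integral_mul_const]
  refine intervalIntegral.integral_mono_on hx
    ((intervalIntegral.intervalIntegrable_rpow' (by linarith)).mul_const _)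
    (intervalIntegrable_lowerGamma hα1 x) fun u hu => ?_
  exact mul_le_mul_of_nonneg_left (Real.exp_le_exp.2 (by linarith [hu.2]))
    (Real.rpow_nonneg hu.1 _)

theorem one_div_le_four_mul_lowerGamma_half {α : ℝ} (hα0 : 0 < α) (hα1 : α < 1) :
    1 / (1 - α) ≤ 4 * lowerGamma (1 - α) (1 / 2) := by
  have h := le_lowerGamma hα1 (by norm_num : (0 : ℝ) ≤ 1 / 2)
  have hα : 0 < 1 - α := by linarith
  have h1 : (1 / 2 : ℝ) ≤ (1 / 2) ^ (1 - α) := by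
    nth_rewrite 1 [← Real.rpow_one (1 / 2 : ℝ)]
    exact Real.rpow_le_rpow_of_exponent_ge (by norm_num) (by norm_num) (by linarith)
  have h2 : (1 / 2 : ℝ) ≤ Real.exp (-(1 / 2)) := by
    linarith [Real.one_sub_le_exp_neg (1 / 2)]
  have h3 : 1 / 2 / (1 - α) * (1 / 2) ≤ (1 / 2) ^ (1 - α) / (1 - α) * Real.exp (-(1 / 2)) := by
    gcongr
  have h4 : 1 / (1 - α) = 4 * (1 / 2 / (1 - α) * (1 / 2)) := by ring
  linarith

theorem two_rpow_sub_one_mul_lowerGamma_le {α : ℝ} (hα0 : 0 < α) (hα1 : α < 1) :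
    ((2 : ℝ) ^ α - 1) * lowerGamma (1 - α) 2 ≤ 2 * α / (1 - α) := by
  have hα : 0 < 1 - α := by linarith
  have h0 : (1 : ℝ) ≤ 2 ^ α := Real.one_le_rpow (by norm_num) hα0.le
  have h1 := mul_le_mul_of_nonneg_left (lowerGamma_le hα1 (by norm_num : (0 : ℝ) ≤ 2))
    (by linarith : (0 : ℝ) ≤ 2 ^ α - 1)
  refine h1.trans ?_
  rw [← mul_div_assoc]
  refine div_le_div_of_nonneg_right ?_ hα.le
  have h2 : (2 : ℝ) ^ α * 2 ^ (1 - α) = 2 := by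
    rw [← Real.rpow_add (by norm_num)]; norm_num
  have h3 : 2 * (1 - α) ≤ (2 : ℝ) ^ (1 - α) := by
    have h4 := Real.add_one_le_exp (-(α * Real.log 2))
    have h5 : (2 : ℝ) ^ (1 - α) = 2 * Real.exp (-(α * Real.log 2)) := by
      rw [Real.rpow_sub (by norm_num), Real.rpow_one, Real.rpow_def_of_pos (by norm_num),
        Real.exp_neg, mul_comm (Real.log 2)]
      rfl
    rw [h5]
    nlinarith [Real.log_two_lt_d9]
  linarith

/-! ### Zipf's law -/

theorem integral_Ioi_rpow_neg {s : ℝ} (hs : 1 < s) {N : ℕ} (hN : 0 < N) :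
    ∫ x in Set.Ioi (N : ℝ), x ^ (-s) = (N : ℝ) ^ (1 - s) / (s - 1) := by
  rw [integral_Ioi_rpow_of_lt (by linarith) (by exact_mod_cast hN), neg_div,
    ← div_neg, show -(-s + 1) = s - 1 by ring, show -s + 1 = 1 - s by ring]

theorem antitoneOn_rpow_neg {s : ℝ} (hs : 1 < s) {N : ℕ} (hN : 0 < N) :
    AntitoneOn (fun x : ℝ => x ^ (-s)) (Set.Ici (N : ℝ)) := by
  intro x hx y _ hxy
  have : (0 : ℝ) < N := by exact_mod_cast hN
  exact Real.rpow_le_rpow_of_nonpos (this.trans_le hx) hxy (by linarith)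

theorem tsum_rpow_neg_le {s : ℝ} (hs : 1 < s) {N : ℕ} (hN : 0 < N) :
    ∑' k : ℕ, ((k + N : ℕ) : ℝ) ^ (-s) ≤ (N : ℝ) ^ (-s) + (N : ℝ) ^ (1 - s) / (s - 1) := by
  have hsum : Summable fun k : ℕ => ((k + N : ℕ) : ℝ) ^ (-s) :=
    (summable_nat_add_iff N).2 (Real.summable_nat_rpow.2 (by linarith))
  rw [hsum.tsum_eq_zero_add, zero_add, ← integral_Ioi_rpow_neg hs hN]
  refine add_le_add le_rfl (le_trans (le_of_eq ?_)
    ((antitoneOn_rpow_neg hs hN).tsum_comp_add_le_integral N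
      (integrableOn_Ioi_rpow_of_lt (by linarith) (by exact_mod_cast hN)) fun t ht =>
      Real.rpow_nonneg ((Nat.cast_nonneg N).trans (le_of_lt ht)) _))
  refine tsum_congr fun k => ?_
  rw [add_right_comm]

theorem le_tsum_rpow_neg {s : ℝ} (hs : 1 < s) {N : ℕ} (hN : 0 < N) :
    (N : ℝ) ^ (1 - s) / (s - 1) ≤ ∑' k : ℕ, ((k + N : ℕ) : ℝ) ^ (-s) := by
  rw [← integral_Ioi_rpow_neg hs hN]
  exact (antitoneOn_rpow_neg hs hN).integral_le_tsum_comp_add N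
    (Real.summable_nat_rpow.2 (by linarith)) fun t ht =>
      Real.rpow_nonneg ((Nat.cast_nonneg N).trans (le_of_lt ht)) _

theorem zipfProb_pos {α : ℝ} (hα0 : 0 < α) (hα1 : α < 1) (k : ℕ+) : 0 < zipfProb α k :=
  div_pos (Real.rpow_pos_of_pos (by exact_mod_cast k.pos) _)
    (zetaSeries_pos (by rw [lt_div_iff₀ hα0]; linarith))

theorem zipfProb_lt_one {α : ℝ} (hα0 : 0 < α) (hα1 : α < 1) (k : ℕ+) : zipfProb α k < 1 := by
  have h := sum_le_hasSum {k, k + 1} (fun b _ => (zipfProb_pos hα0 hα1 b).le)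
    (hasSum_zipfProb hα0 hα1)
  rw [Finset.sum_pair (by simp [← PNat.coe_inj])] at h
  linarith [zipfProb_pos hα0 hα1 (k + 1)]

theorem zipfProb_div_two_le_iff {α : ℝ} (hα0 : 0 < α) (hα1 : α < 1) (k m : ℕ+) :
    zipfProb α m / 2 ≤ zipfProb α k ↔ (k : ℝ) ≤ 2 ^ α * m := by
  have hZ := zetaSeries_pos (by rw [lt_div_iff₀ hα0]; linarith : 1 < 1 / α)
  have hm : (0 : ℝ) < m := by exact_mod_cast m.pos
  have hk : (0 : ℝ) < k := by exact_mod_cast k.pos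
  have h2 : (m : ℝ) ^ (-(1 / α)) / 2 = (2 ^ α * m) ^ (-(1 / α)) := by
    rw [Real.mul_rpow (by positivity) hm.le, ← Real.rpow_mul (by norm_num),
      show α * -(1 / α) = -1 by field_simp, Real.rpow_neg_one]
    ring
  rw [zipfProb, zipfProb, div_right_comm, h2, div_le_div_iff_of_pos_right hZ,
    Real.rpow_le_rpow_iff_of_neg (by positivity) hk (by simpa using hα0)]

theorem zipfProb_le_iff {α : ℝ} (hα0 : 0 < α) (hα1 : α < 1) (k m : ℕ+) :
    zipfProb α m ≤ zipfProb α k ↔ (k : ℝ) ≤ m := by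
  have hZ := zetaSeries_pos (by rw [lt_div_iff₀ hα0]; linarith : 1 < 1 / α)
  have hm : (0 : ℝ) < m := by exact_mod_cast m.pos
  have hk : (0 : ℝ) < k := by exact_mod_cast k.pos
  rw [zipfProb, zipfProb, div_le_div_iff_of_pos_right hZ,
    Real.rpow_le_rpow_iff_of_neg hm hk (by simpa using hα0)]

/-- If `κ₋(ε) < 1`, then passing from `p_m ≤ ε` to `p_m / 2` picks up at least one new letter. -/
theorem add_one_le_two_rpow_mul_of_kappaMinus_lt_one {α ε : ℝ} (hα0 : 0 < α) (hα1 : α < 1)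
    (hκ : kappaMinus (zipfProb α) ε < 1) {m : ℕ+} (hm : zipfProb α m ≤ ε) :
    (m : ℝ) + 1 ≤ 2 ^ α * m := by
  by_contra! hlt
  have heq : {k | zipfProb α m / 2 ≤ zipfProb α k} = {k | zipfProb α m ≤ zipfProb α k} := by
    ext k
    simp only [Set.mem_ofPred_eq, zipfProb_div_two_le_iff hα0 hα1, zipfProb_le_iff hα0 hα1]
    constructor
    · intro h
      have : (k : ℝ) < m + 1 := h.trans_lt hlt
      have h2 : (k : ℕ) < m + 1 := by exact_mod_cast this
      exact_mod_cast Nat.lt_succ_iff.1 h2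
    · intro h
      exact h.trans (le_mul_of_one_le_left (by positivity)
        (Real.one_le_rpow (by norm_num) hα0.le))
  have hne : countingFn (zipfProb α) (zipfProb α m) ≠ 0 :=
    Set.encard_ne_zero.2 ⟨m, le_refl (zipfProb α m)⟩
  have hfin : countingFn (zipfProb α) (zipfProb α m) ≠ ⊤ := by
    refine Set.encard_ne_top_iff.2 ((Set.finite_Iic m).subset fun k hk => ?_)
    have := (zipfProb_le_iff hα0 hα1 k m).1 hk
    exact_mod_cast this
  have h1 : (countingFn (zipfProb α) (zipfProb α m) : ℝ≥0∞)
      / (countingFn (zipfProb α) (zipfProb α m / 2) : ℝ≥0∞) = 1 := by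
    rw [show countingFn (zipfProb α) (zipfProb α m / 2) = countingFn (zipfProb α) (zipfProb α m)
      from congrArg Set.encard heq]
    exact ENNReal.div_self (by simpa using hne) (by simpa using hfin)
  refine absurd hκ (not_lt.2 ?_)
  rw [← h1]
  exact le_iSup₂_of_le (zipfProb α m) ⟨zipfProb_pos hα0 hα1 m, hm⟩ le_rfl

theorem ofReal_kappa_bound_lt_one {α : ℝ} (hα0 : 0 < α) :
    ENNReal.ofReal (((2 : ℝ) ^ α + 1) / (2 : ℝ) ^ (α + 1)) < 1 := by
  have h0 : (1 : ℝ) < 2 ^ α := Real.one_lt_rpow (by norm_num) hα0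
  rw [ENNReal.ofReal_lt_one, div_lt_one (by positivity), Real.rpow_add (by norm_num),
    Real.rpow_one]
  linarith

/-- The real number `K = (n / ζ(1/α)) ^ α`, for which `p_k ≥ 1 / n` holds exactly when `k ≤ K`. -/
noncomputable def zipfCutoff (α : ℝ) (n : ℕ) : ℝ :=
  ((n : ℝ) / zetaSeries (1 / α)) ^ α

section Cutoff

variable {α : ℝ} {n : ℕ}

theorem two_le_zipfCutoff (hα0 : 0 < α) (hα1 : α < 1)
    (hn : (2 : ℝ) ^ (1 / α) * zetaSeries (1 / α) ≤ n) : 2 ≤ zipfCutoff α n := by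
  have hZ := zetaSeries_pos (by rw [lt_div_iff₀ hα0]; linarith : 1 < 1 / α)
  have h := Real.rpow_le_rpow (by positivity) ((le_div_iff₀ hZ).2 hn) hα0.le
  rwa [← Real.rpow_mul (by norm_num), one_div_mul_cancel hα0.ne', Real.rpow_one] at h

theorem zipfCutoff_rpow_neg (hα0 : 0 < α) (hα1 : α < 1) :
    zipfCutoff α n ^ (-(1 / α)) = zetaSeries (1 / α) / n := by
  have hZ := zetaSeries_pos (by rw [lt_div_iff₀ hα0]; linarith : 1 < 1 / α)
  rw [zipfCutoff, ← Real.rpow_mul (by positivity), show α * -(1 / α) = -1 by field_simp,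
    Real.rpow_neg_one, inv_div]

theorem zipfCutoff_rpow_one_sub (hα0 : 0 < α) (hα1 : α < 1) (hK : 0 < zipfCutoff α n) :
    zipfCutoff α n ^ (1 - 1 / α) = zipfCutoff α n * (zetaSeries (1 / α) / n) := by
  rw [sub_eq_add_neg, Real.rpow_add hK, Real.rpow_one, zipfCutoff_rpow_neg hα0 hα1]

theorem zeta_rpow_div_eq_zipfCutoff_div (hα0 : 0 < α) (hα1 : α < 1) (hn : 0 < n) :
    zetaSeries (1 / α) ^ (-α) / (n : ℝ) ^ (1 - α) = zipfCutoff α n / n := by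
  have hZ := zetaSeries_pos (by rw [lt_div_iff₀ hα0]; linarith : 1 < 1 / α)
  have hn' : (0 : ℝ) < n := by exact_mod_cast hn
  rw [zipfCutoff, Real.div_rpow hn'.le hZ.le, Real.rpow_neg hZ.le, Real.rpow_sub hn',
    Real.rpow_one]
  have h1 := (Real.rpow_pos_of_pos hZ α).ne'
  have h2 := (Real.rpow_pos_of_pos hn' α).ne'
  field_simp

/-- The condition on `κ₋` forces the cutoff to be at least of order `1 / α`. -/
theorem one_add_inv_zipfCutoff_rpow_le (hα0 : 0 < α) (hα1 : α < 1)
    (hK : 2 ≤ zipfCutoff α n) (hκ : kappaMinus (zipfProb α) (2 / (n : ℝ)) < 1) :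
    (1 + 1 / zipfCutoff α n) ^ (1 / α) ≤ 4 := by
  set K := zipfCutoff α n with hKdef
  have hK0 : 0 < K := by linarith
  have hZ := zetaSeries_pos (by rw [lt_div_iff₀ hα0]; linarith : 1 < 1 / α)
  have hA : (0 : ℝ) < 2 ^ α := by positivity
  have hA2 : (2 : ℝ) ^ α < 2 := by
    simpa using Real.rpow_lt_rpow_of_exponent_lt (by norm_num : (1 : ℝ) < 2) hα1
  -- the smallest index `m` with `p_m ≤ 2 / n`
  let m : ℕ+ := ⟨⌈K / 2 ^ α⌉₊, Nat.ceil_pos.2 (by positivity)⟩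
  have hm1 : K / 2 ^ α ≤ m := Nat.le_ceil _
  have hm2 : (m : ℝ) < K / 2 ^ α + 1 := Nat.ceil_lt_add_one (by positivity)
  have hpm : zipfProb α m ≤ 2 / n := by
    have h := Real.rpow_le_rpow_of_nonpos (by positivity) hm1
      (by simpa using hα0.le : -(1 / α) ≤ 0)
    rw [Real.div_rpow hK0.le hA.le, hKdef, zipfCutoff_rpow_neg hα0 hα1,
      ← Real.rpow_mul (by norm_num), show α * -(1 / α) = -1 by field_simp,
      Real.rpow_neg_one] at h
    rw [zipfProb, div_le_iff₀ hZ]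
    refine h.trans (le_of_eq ?_)
    field_simp
  have hstep := add_one_le_two_rpow_mul_of_kappaMinus_lt_one hα0 hα1 hκ hpm
  have hmpos : (0 : ℝ) < m := by exact_mod_cast m.pos
  have hm_two : (2 : ℝ) ≤ m := by
    have h1 : (1 : ℝ) < m := by nlinarith
    have h2 : 1 < (m : ℕ) := by exact_mod_cast h1
    exact_mod_cast h2
  have hbase : 1 + 1 / (m : ℝ) ≤ 2 ^ α := by
    rw [one_add_div hmpos.ne', div_le_iff₀ hmpos]
    exact hstep
  have hKm : (m : ℝ) ^ 2 - 1 ≤ K * m := by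
    have h1 : ((m : ℝ) - 1) * 2 ^ α < K := by
      rw [← lt_div_iff₀ hA]; linarith
    nlinarith
  have hsq : 1 + 1 / K ≤ (2 ^ α) ^ 2 := by
    have h1 : 1 / K ≤ 2 / m := by
      rw [div_le_div_iff₀ hK0 hmpos]
      nlinarith
    have h2 : (1 + 1 / (m : ℝ)) ^ 2 ≤ (2 ^ α) ^ 2 := by gcongr
    have h3 : (1 + 1 / (m : ℝ)) ^ 2 = 1 + 2 / m + (1 / m) ^ 2 := by ring
    nlinarith [sq_nonneg (1 / (m : ℝ))]
  refine (Real.rpow_le_rpow (by positivity) hsq (by positivity)).trans (le_of_eq ?_)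
  rw [← Real.rpow_natCast, ← Real.rpow_mul hA.le, ← Real.rpow_mul (by norm_num),
    show α * ((2 : ℕ) * (1 / α)) = (2 : ℕ) by field_simp, Real.rpow_natCast]
  norm_num

theorem summable_zipfProb_mul_pow_nat (hα0 : 0 < α) (hα1 : α < 1) (N : ℕ) :
    Summable fun k : ℕ =>
      zipfProb α (k + N).succPNat * (1 - zipfProb α (k + N).succPNat) ^ n :=
  (summable_mul_one_sub_pow (fun k => (zipfProb_pos hα0 hα1 k).le)
    (hasSum_zipfProb hα0 hα1) n).comp_injective
      (Nat.succPNat_injective.comp (add_left_injective N))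

theorem tsum_zipfProb_mul_pow_eq (hα0 : 0 < α) (hα1 : α < 1) (N : ℕ) :
    ∑' k, zipfProb α k * (1 - zipfProb α k) ^ n
      = ∑ k ∈ Finset.range N, zipfProb α k.succPNat * (1 - zipfProb α k.succPNat) ^ n
        + ∑' k : ℕ, zipfProb α (k + N).succPNat * (1 - zipfProb α (k + N).succPNat) ^ n := by
  have hsum : Summable fun k : ℕ =>
      zipfProb α k.succPNat * (1 - zipfProb α k.succPNat) ^ n :=
    summable_zipfProb_mul_pow_nat hα0 hα1 0
  rw [hsum.sum_add_tsum_nat_add N]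
  exact (Equiv.pnatEquivNat.symm.tsum_eq _).symm

theorem zipfProb_succPNat (α : ℝ) (k N : ℕ) :
    zipfProb α (k + N).succPNat
      = ((k + (N + 1) : ℕ) : ℝ) ^ (-(1 / α)) / zetaSeries (1 / α) := by
  rw [zipfProb]
  simp [add_assoc]

/-- The letters `k ≤ K` contribute at most `1 / (n e)` each; the others are bounded by their total
mass. -/
theorem tsum_zipfProb_mul_pow_le (hα0 : 0 < α) (hα1 : α < 1) (hn : 0 < n)
    (hK : 2 ≤ zipfCutoff α n) :
    ∑' k, zipfProb α k * (1 - zipfProb α k) ^ n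
      ≤ (Real.exp (-1) + 1 / (1 - α)) * (zipfCutoff α n / n) := by
  have hs : 1 < 1 / α := by rw [lt_div_iff₀ hα0]; linarith
  have hZ := zetaSeries_pos hs
  have hn' : (0 : ℝ) < n := by exact_mod_cast hn
  have hsum : Summable fun k : ℕ => ((k + (⌊zipfCutoff α n⌋₊ + 1) : ℕ) : ℝ) ^ (-(1 / α)) :=
    (summable_nat_add_iff _).2 (Real.summable_nat_rpow.2 (by linarith))
  have htail := tsum_rpow_neg_le hs (Nat.succ_pos ⌊zipfCutoff α n⌋₊)
  have hfl := Nat.floor_le (by linarith : 0 ≤ zipfCutoff α n)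
  have hlt := (Nat.lt_floor_add_one (zipfCutoff α n)).le
  have hr1 := zipfCutoff_rpow_neg (n := n) hα0 hα1
  have hr2 := zipfCutoff_rpow_one_sub (n := n) hα0 hα1 (by linarith)
  set K := zipfCutoff α n
  set N := ⌊K⌋₊
  have hp0 := zipfProb_pos hα0 hα1
  have hp1 := zipfProb_lt_one hα0 hα1
  rw [tsum_zipfProb_mul_pow_eq hα0 hα1 N, add_mul]
  refine add_le_add ?_ ?_
  · refine (Finset.sum_le_sum fun k _ => mul_one_sub_pow_le (hp0 _).le (hp1 _).le hn).trans ?_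
    rw [Finset.sum_const, Finset.card_range, nsmul_eq_mul]
    refine (mul_le_mul_of_nonneg_right hfl (by positivity)).trans (le_of_eq ?_)
    rw [Real.exp_neg]
    field_simp
  · have h1 : ∑' k : ℕ, zipfProb α (k + N).succPNat * (1 - zipfProb α (k + N).succPNat) ^ n
        ≤ ∑' k : ℕ, ((k + (N + 1) : ℕ) : ℝ) ^ (-(1 / α)) / zetaSeries (1 / α) := by
      refine Summable.tsum_le_tsum (fun k => ?_) (summable_zipfProb_mul_pow_nat hα0 hα1 N)
        (hsum.div_const _)
      rw [← zipfProb_succPNat]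
      exact mul_le_of_le_one_right (hp0 _).le
        (pow_le_one₀ (by linarith [hp1 (k + N).succPNat]) (by linarith [hp0 (k + N).succPNat]))
    refine h1.trans ?_
    rw [tsum_div_const, div_le_iff₀ hZ]
    have h2 : ((N + 1 : ℕ) : ℝ) ^ (-(1 / α)) ≤ K ^ (-(1 / α)) :=
      Real.rpow_le_rpow_of_nonpos (by linarith) (by push_cast; exact hlt) (by linarith)
    have h3 : ((N + 1 : ℕ) : ℝ) ^ (1 - 1 / α) ≤ K ^ (1 - 1 / α) :=
      Real.rpow_le_rpow_of_nonpos (by linarith) (by push_cast; exact hlt) (by linarith)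
    have h4 : ((N + 1 : ℕ) : ℝ) ^ (1 - 1 / α) / (1 / α - 1) ≤ K ^ (1 - 1 / α) / (1 / α - 1) :=
      div_le_div_of_nonneg_right h3 (by linarith)
    rw [hr1] at h2
    rw [hr2] at h4
    refine htail.trans ((add_le_add h2 h4).trans ?_)
    have hα : 0 < 1 - α := by linarith
    have h5 : 1 / (1 - α) * (K / n) * zetaSeries (1 / α)
        - (zetaSeries (1 / α) / n + K * (zetaSeries (1 / α) / n) / (1 / α - 1))
        = zetaSeries (1 / α) / n * (K - 1) := by
      have : 1 / α - 1 = (1 - α) / α := by field_simp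
      rw [this]
      field_simp
      ring
    have h6 : 0 ≤ zetaSeries (1 / α) / n * (K - 1) := mul_nonneg (by positivity) (by linarith)
    linarith

/-- Bernoulli's inequality with exponent `n / 2`, squared. -/
theorem one_fourth_le_one_sub_pow {p : ℝ} (hn : 2 ≤ n) (hp : p ≤ 1 / n) :
    1 / 4 ≤ (1 - p) ^ n := by
  have hn' : (2 : ℝ) ≤ n := by exact_mod_cast hn
  have hp1 : n * p ≤ 1 := by
    rw [le_div_iff₀ (by linarith)] at hp; linarith
  have hple : p ≤ 1 := by nlinarith
  have h := one_add_mul_self_le_rpow_one_add (by linarith : -1 ≤ -p)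
    (by linarith : (1 : ℝ) ≤ n / 2)
  have h1 : (1 / 2 : ℝ) ≤ (1 + -p) ^ ((n : ℝ) / 2) := by linarith
  have h2 : ((1 + -p) ^ ((n : ℝ) / 2)) ^ 2 = (1 - p) ^ n := by
    rw [← Real.rpow_natCast, ← Real.rpow_mul (by linarith),
      show (n : ℝ) / 2 * (2 : ℕ) = n by push_cast; ring, Real.rpow_natCast, ← sub_eq_add_neg]
  rw [← h2]
  nlinarith

/-- The letters `k > K` are each unseen with probability at least `1 / 4`. -/
theorem le_tsum_zipfProb_mul_pow (hα0 : 0 < α) (hα1 : α < 1) (hn : 2 ≤ n)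
    (hK : 2 ≤ zipfCutoff α n) (hK4 : (1 + 1 / zipfCutoff α n) ^ (1 / α) ≤ 4) :
    α / (16 * (1 - α)) * (zipfCutoff α n / n)
      ≤ ∑' k, zipfProb α k * (1 - zipfProb α k) ^ n := by
  have hs : 1 < 1 / α := by rw [lt_div_iff₀ hα0]; linarith
  have hZ := zetaSeries_pos hs
  have hn' : (0 : ℝ) < n := by exact_mod_cast (by omega : 0 < n)
  have hsum : Summable fun k : ℕ => ((k + (⌊zipfCutoff α n⌋₊ + 1) : ℕ) : ℝ) ^ (-(1 / α)) :=
    (summable_nat_add_iff _).2 (Real.summable_nat_rpow.2 (by linarith))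
  have htail := le_tsum_rpow_neg hs (Nat.succ_pos ⌊zipfCutoff α n⌋₊)
  have hfl := Nat.floor_le (by linarith : 0 ≤ zipfCutoff α n)
  have hlt := (Nat.lt_floor_add_one (zipfCutoff α n)).le
  have hr1 := zipfCutoff_rpow_neg (n := n) hα0 hα1
  have hr2 := zipfCutoff_rpow_one_sub (n := n) hα0 hα1 (by linarith)
  set K := zipfCutoff α n
  set N := ⌊K⌋₊
  have hK0 : 0 < K := by linarith
  have hp0 := zipfProb_pos hα0 hα1
  have hp1 := zipfProb_lt_one hα0 hα1
  rw [tsum_zipfProb_mul_pow_eq hα0 hα1 N]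
  have hhead : 0 ≤ ∑ k ∈ Finset.range N,
      zipfProb α k.succPNat * (1 - zipfProb α k.succPNat) ^ n :=
    Finset.sum_nonneg fun k _ =>
      mul_nonneg (hp0 _).le (pow_nonneg (by linarith [hp1 k.succPNat]) _)
  have h1 : ∑' k : ℕ, ((k + (N + 1) : ℕ) : ℝ) ^ (-(1 / α)) / zetaSeries (1 / α) * (1 / 4)
      ≤ ∑' k : ℕ, zipfProb α (k + N).succPNat * (1 - zipfProb α (k + N).succPNat) ^ n := by
    refine Summable.tsum_le_tsum (fun k => ?_) ((hsum.div_const _).mul_right _)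
      (summable_zipfProb_mul_pow_nat hα0 hα1 N)
    rw [← zipfProb_succPNat]
    refine mul_le_mul_of_nonneg_left (one_fourth_le_one_sub_pow hn ?_) (hp0 _).le
    have hKk : K ≤ ((k + (N + 1) : ℕ) : ℝ) := by
      push_cast
      linarith [Nat.cast_nonneg (α := ℝ) k]
    have h := Real.rpow_le_rpow_of_nonpos hK0 hKk (by linarith : -(1 / α) ≤ 0)
    rw [hr1] at h
    rw [zipfProb_succPNat, div_le_iff₀ hZ]
    refine h.trans (le_of_eq ?_)
    ring
  rw [tsum_mul_right, tsum_div_const] at h1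
  have h2 : K ^ (1 - 1 / α) / 4 ≤ ((N + 1 : ℕ) : ℝ) ^ (1 - 1 / α) := by
    have h3 : (K * (1 + 1 / K)) ^ (1 - 1 / α) ≤ ((N + 1 : ℕ) : ℝ) ^ (1 - 1 / α) := by
      refine Real.rpow_le_rpow_of_nonpos (by positivity) ?_ (by linarith)
      rw [mul_add, mul_one_div_cancel hK0.ne']
      push_cast
      linarith
    refine le_trans ?_ h3
    rw [Real.mul_rpow hK0.le (by positivity), div_eq_mul_inv]
    refine mul_le_mul_of_nonneg_left ?_ (by positivity)
    rw [← neg_sub, Real.rpow_neg (by positivity)]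
    refine inv_anti₀ (by positivity) (le_trans ?_ hK4)
    exact Real.rpow_le_rpow_of_exponent_le (by simp [hK0.le]) (by linarith)
  rw [hr2] at h2
  have h5 : K * (zetaSeries (1 / α) / n) / 4 / (1 / α - 1)
      ≤ ∑' k : ℕ, ((k + (N + 1) : ℕ) : ℝ) ^ (-(1 / α)) :=
    (div_le_div_of_nonneg_right h2 (by linarith)).trans htail
  have h6 := mul_le_mul_of_nonneg_right (div_le_div_of_nonneg_right h5 hZ.le)
    (by norm_num : (0 : ℝ) ≤ 1 / 4)
  have h7 : K * (zetaSeries (1 / α) / n) / 4 / (1 / α - 1) / zetaSeries (1 / α) * (1 / 4)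
      = α / (16 * (1 - α)) * (K / n) := by
    have : 1 / α - 1 = (1 - α) / α := by field_simp
    have hα : 1 - α ≠ 0 := by linarith
    rw [this]
    field_simp
    norm_num
  linarith

end Cutoff

/-! ### The missing mass of a Zipf sample -/

theorem occupancyProb_zero_eq_tsum_unseen {Ω A : Type*} (p : A → ℝ) {n : ℕ} (X : Fin n → Ω → A)
    (ω : Ω) :
    occupancyProb p (fun i => X i ω) 0 = ∑' a, p a * unseen X Finset.univ a ω := by
  unfold occupancyProb
  refine tsum_congr fun a => ?_
  have h : sampleCount (fun i => X i ω) a = 0 ↔ ∀ i ∈ Finset.univ, X i ω ≠ a := by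
    rw [sampleCount, Set.ncard_eq_zero, Set.eq_empty_iff_forall_notMem]
    simp
  unfold unseen
  by_cases ha : sampleCount (fun i => X i ω) a = 0
  · rw [if_pos ha, if_pos (h.1 ha)]
  · rw [if_neg ha, if_neg (h.not.1 ha)]

theorem mainTheorem10 (α : ℝ) (hα0 : 0 < α) (hα1 : α < 1)
    (n : ℕ) (hn : max 2 ((2 : ℝ) ^ (1 / α) * zetaSeries (1 / α)) ≤ (n : ℝ))
    (hκ : kappaMinus (zipfProb α) (2 / (n : ℝ))
      ≤ ENNReal.ofReal (((2 : ℝ) ^ α + 1) / (2 : ℝ) ^ (α + 1)))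
    (hint : lowerGamma (1 - α) 2 / 2
      ≤ ∫ u in (0 : ℝ)..2, u ^ (-α) * (1 - u / (n : ℝ)) ^ n)
    {Ω : Type*} [MeasurableSpace Ω] (μ : Measure Ω) [IsProbabilityMeasure μ]
    (X : Fin n → Ω → ℕ+) (hX : ∀ i, Measurable (X i)) (hindep : iIndepFun X μ)
    (hlaw : ∀ i k, μ.real {ω | X i ω = k} = zipfProb α k)
    (t : ℝ) (ht : 0 < t) :
    1 - 2 * Real.exp (-t) ≤
      μ.real {ω | missingMassLower n t α ≤ occupancyProb (zipfProb α) (fun i => X i ω) 0 ∧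
        occupancyProb (zipfProb α) (fun i => X i ω) 0 ≤ missingMassUpper n t α} := by
  have hn2 : 2 ≤ n := by exact_mod_cast (le_max_left _ _).trans hn
  have hn' : (0 : ℝ) < n := by exact_mod_cast (by omega : 0 < n)
  have hα : 0 < 1 - α := by linarith
  have hK := two_le_zipfCutoff hα0 hα1 ((le_max_right _ _).trans hn)
  have hK4 := one_add_inv_zipfCutoff_rpow_le hα0 hα1 hK
    (hκ.trans_lt (ofReal_kappa_bound_lt_one hα0))
  have hKn : 0 ≤ zipfCutoff α n / n := div_nonneg (by linarith) hn'.le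
  set E := ∑' k, zipfProb α k * (1 - zipfProb α k) ^ n with hE
  have hlower : missingMassLower n t α ≤ E - √(2 * t / (n * Real.exp 1)) := by
    rw [missingMassLower, zeta_rpow_div_eq_zipfCutoff_div hα0 hα1 (by omega)]
    refine sub_le_sub_right (le_trans (mul_le_mul_of_nonneg_right ?_ hKn)
      (le_tsum_zipfProb_mul_pow hα0 hα1 hn2 hK hK4)) _
    rw [div_le_iff₀ (by norm_num)]
    refine (two_rpow_sub_one_mul_lowerGamma_le hα0 hα1).trans (le_of_eq ?_)
    field_simp
    norm_num
  have hupper : E + √(t / n) ≤ missingMassUpper n t α := by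
    rw [missingMassUpper, zeta_rpow_div_eq_zipfCutoff_div hα0 hα1 (by omega)]
    refine add_le_add_left ((tsum_zipfProb_mul_pow_le hα0 hα1 (by omega) hK).trans ?_) _
    exact mul_le_mul_of_nonneg_right
      (add_le_add_right (one_div_le_four_mul_lowerGamma_half hα0 hα1) _) hKn
  have hne : (Finset.univ : Finset (Fin n)).Nonempty := ⟨⟨0, by omega⟩, Finset.mem_univ _⟩
  have hp0 := zipfProb_pos hα0 hα1
  have hleft := measure_tsum_unseen_le_sub_le hX hindep hlaw (fun k => (hp0 k).le)
    (hasSum_zipfProb hα0 hα1) hne ht.le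
  have hright := measure_add_le_tsum_unseen_le hX hindep hlaw hp0 (zipfProb_lt_one hα0 hα1)
    (hasSum_zipfProb hα0 hα1) hne ht.le
  simp only [Finset.card_univ, Fintype.card_fin, ← hE] at hleft hright
  simp_rw [occupancyProb_zero_eq_tsum_unseen]
  set G := {ω | missingMassLower n t α ≤ ∑' k, zipfProb α k * unseen X Finset.univ k ω ∧
    ∑' k, zipfProb α k * unseen X Finset.univ k ω ≤ missingMassUpper n t α}
  set L := {ω | ∑' k, zipfProb α k * unseen X Finset.univ k ω
    ≤ E - √(2 * t / (n * Real.exp 1))}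
  set U := {ω | E + √(t / n) ≤ ∑' k, zipfProb α k * unseen X Finset.univ k ω}
  have hcover : (Set.univ : Set Ω) ⊆ G ∪ (L ∪ U) := by
    intro ω _
    by_cases h1 : ω ∈ L
    · exact Or.inr (Or.inl h1)
    by_cases h2 : ω ∈ U
    · exact Or.inr (Or.inr h2)
    exact Or.inl ⟨hlower.trans (not_le.1 h1).le, (not_le.1 h2).le.trans hupper⟩
  have h1 : (1 : ℝ) ≤ μ.real G + (μ.real L + μ.real U) := by
    calc (1 : ℝ) = μ.real Set.univ := by simp
      _ ≤ μ.real (G ∪ (L ∪ U)) := measureReal_mono hcover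
      _ ≤ μ.real G + μ.real (L ∪ U) := measureReal_union_le _ _
      _ ≤ μ.real G + (μ.real L + μ.real U) := by gcongr; exact measureReal_union_le _ _
  linarith
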